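/- Let $\pi : X \to S$ be a holomorphic proper submersion of complex manifolds with connected fibers, and let $\mathcal F$ and $\mathcal G$ be locally free $\mathcal O_X$-modules of rank $r$ and $p$ respectively, where $\mathcal O_X$ denotes the sheaf of holomorphic functions on $X$. A morphism $P$ of sheaves of abelian groups between $\mathcal O_X$-modules is called $S$-linear if $P((g\circ\pi)|_U\, s) = (g\circ\pi)|_U\, P(s)$ for all open $W \subset S$, $U \subset \pi^{-1}(W)$, all $g \in \mathcal O_S(W)$ and all sections $s$ over $U$. Let - $\mathcal{H}om_{\mathcal O_X}(\mathcal F,\mathcal G)$ be the $\mathcal O_X$-module of $\mathcal O_X$-linear morphisms; - $\mathcal{D}iff^1_S(\mathcal F,\mathcal G)$ be the $\mathcal O_X$-module of first order $S$-differential operators: its sections over an open $U \subset X$ are the $S$-linear morphisms $P : \mathcal F|_U \to \mathcal G|_U$ such that, for every open $V \subset U$ and $f \in \mathcal O_X(V)$, the bracket $[P|_V, f] : s \mapsto P(fs) - fP(s)$ is $\mathcal O_V$-linear; - $\mathcal{D}er_S(\mathcal O_X,\mathcal H)$, for an $\mathcal O_X$-module $\mathcal H$, be the $\mathcal O_X$-module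 of $S$-derivations: its sections over an open $U \subset X$ are the $S$-linear morphisms $\delta : \mathcal O_U \to \mathcal H|_U$ with $\delta(ab) = a\,\delta(b) + b\,\delta(a)$. Let $\iota$ be the inclusion $\mathcal{H}om_{\mathcal O_X}(\mathcal F,\mathcal G) \to \mathcal{D}iff^1_S(\mathcal F,\mathcal G)$, and let $\sigma_1$ be the symbol map, which sends $P \in \mathcal{D}iff^1_S(\mathcal F,\mathcal G)(U)$ to the $S$-derivation $f \mapsto [P|_V, f]$ ($V \subset U$ open, $f \in \mathcal O_X(V)$). Then $$0 \to \mathcal{H}om_{\mathcal O_X}(\mathcal F,\mathcal G) \xrightarrow{\ \iota\ } \mathcal{D}iff^1_S(\mathcal F,\mathcal G) \xrightarrow{\ \sigma_1\ } \mathcal{D}er_S\big(\mathcal O_X, \mathcal{H}om_{\mathcal O_X}(\mathcal F,\mathcal G)\big) \to 0$$ is an exact sequence of $\mathcal O_X$-modules. In particular, $\sigma_1$ is a surjective morphism of sheaves. -/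

import Mathlib

open CategoryTheory TopologicalSpace Opposite AlgebraicGeometry
open scoped Manifold ContDiff

universe u

namespace RelDiff

noncomputable section

/-- The structure sheaf of a ringed space, as a sheaf of rings. -/
def ringSheaf (X : RingedSpace.{u, u}) :
    Sheaf (Opens.grothendieckTopology X.carrier) RingCat.{u} :=
  (sheafCompose _ (forget₂ CommRingCat.{u} RingCat.{u})).obj X.sheaf

/-- The category of `𝒪_X`-modules on a ringed space `X`. -/
abbrev OModule (X : RingedSpace.{u, u}) := SheafOfModules.{u} (ringSheaf X)

variable {X S : RingedSpace.{u, u}}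

/-- The ring `𝒪_X(U)`. -/
abbrev Fn (X : RingedSpace.{u, u}) (U : Opens X.carrier) : Type u := X.presheaf.obj (op U)

/-- The group `F(U)` of sections of an `𝒪_X`-module. -/
abbrev Sec (F : OModule X) (U : Opens X.carrier) : Type u := F.val.obj (op U)

instance (F : OModule X) (U : Opens X.carrier) : Module (Fn X U) (Sec F U) :=
  (F.val.obj (op U)).isModule

/-- Restriction of functions, `𝒪_X(U) → 𝒪_X(V)` for `V ⊆ U`. -/
def fres {U V : Opens X.carrier} (h : V ≤ U) : Fn X U →+* Fn X V :=
  (X.presheaf.map (homOfLE h).op).hom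

/-- Restriction of sections, `F(U) → F(V)` for `V ⊆ U`. -/
def res (F : OModule X) {U V : Opens X.carrier} (h : V ≤ U) : Sec F U →+ Sec F V :=
  (F.val.presheaf.map (homOfLE h).op).hom

theorem fres_fres {U V W : Opens X.carrier} (h : V ≤ U) (h' : W ≤ V) (f : Fn X U) :
    fres h' (fres h f) = fres (h'.trans h) f := by
  have := congr($(X.presheaf.map_comp (homOfLE h).op (homOfLE h').op).hom f)
  exact this.symm

theorem fres_self {U : Opens X.carrier} (h : U ≤ U) (f : Fn X U) : fres h f = f :=
  congr($(X.presheaf.map_id (op U)).hom f)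

theorem res_res (F : OModule X) {U V W : Opens X.carrier} (h : V ≤ U) (h' : W ≤ V) (s : Sec F U) :
    res F h' (res F h s) = res F (h'.trans h) s := by
  have := congr($(F.val.presheaf.map_comp (homOfLE h).op (homOfLE h').op).hom s)
  exact this.symm

theorem res_self (F : OModule X) {U : Opens X.carrier} (h : U ≤ U) (s : Sec F U) :
    res F h s = s :=
  congr($(F.val.presheaf.map_id (op U)).hom s)

theorem res_smul (F : OModule X) {U V : Opens X.carrier} (h : V ≤ U) (f : Fn X U) (s : Sec F U) :
    res F h (f • s) = fres h f • res F h s :=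
  F.val.map_smul (homOfLE h).op f s

theorem sec_ext (F : OModule X) {ι : Type u} {V : Opens X.carrier} (U : ι → Opens X.carrier)
    (hU : ∀ i, U i ≤ V) (hc : V ≤ iSup U) {s t : Sec F V}
    (h : ∀ i, res F (hU i) s = res F (hU i) t) : s = t :=
  TopCat.Sheaf.eq_of_locally_eq' (C := AddCommGrpCat.{u}) ⟨F.val.presheaf, F.isSheaf⟩ U V
    (fun i => homOfLE (hU i)) hc s t h

theorem sec_glue (F : OModule X) {ι : Type u} {V : Opens X.carrier} (U : ι → Opens X.carrier)
    (hU : ∀ i, U i ≤ V) (hc : V ≤ iSup U) (s : ∀ i, Sec F (U i))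
    (h : ∀ i j, res F (inf_le_left : U i ⊓ U j ≤ U i) (s i) =
      res F (inf_le_right : U i ⊓ U j ≤ U j) (s j)) :
    ∃ t : Sec F V, ∀ i, res F (hU i) t = s i :=
  (TopCat.Sheaf.existsUnique_gluing' (C := AddCommGrpCat.{u}) ⟨F.val.presheaf, F.isSheaf⟩ U V
    (fun i => homOfLE (hU i)) hc (fun i => (show F.val.presheaf.obj (op (U i)) from s i)) h).exists

/-! ### Morphisms of sheaves of abelian groups over an open set -/

/-- A morphism `F|_U → G|_U` of sheaves of abelian groups. -/
@[ext]
structure AbHom (F G : OModule X) (U : Opens X.carrier) where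
  /-- the component over an open set `V ⊆ U` -/
  app : ∀ V : Opens X.carrier, V ≤ U → (Sec F V →+ Sec G V)
  naturality : ∀ (V W : Opens X.carrier) (hV : V ≤ U) (hW : W ≤ V) (s : Sec F V),
    app W (hW.trans hV) (res F hW s) = res G hW (app V hV s)

namespace AbHom

variable {F G : OModule X} {U V W : Opens X.carrier}

theorem ext' {P Q : AbHom F G U} (h : ∀ V hV s, P.app V hV s = Q.app V hV s) : P = Q := by
  ext V hV s
  exact h V hV s

instance : Zero (AbHom F G U) := ⟨⟨fun _ _ => 0, by simp⟩⟩
instance : Add (AbHom F G U) :=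
  ⟨fun P Q => ⟨fun V hV => P.app V hV + Q.app V hV, by
    intro V W hV hW s
    change P.app W _ _ + Q.app W _ _ = res G hW (P.app V _ _ + Q.app V _ _)
    rw [P.naturality V W hV hW, Q.naturality V W hV hW, map_add]⟩⟩
instance : Neg (AbHom F G U) := ⟨fun P => ⟨fun V hV => -P.app V hV, by
    intro V W hV hW s
    change -P.app W _ _ = res G hW (-P.app V _ _)
    rw [P.naturality V W hV hW, map_neg]⟩⟩

/-- `f • P` is `s ↦ f P(s)`. -/
instance : SMul (Fn X U) (AbHom F G U) :=
  ⟨fun f P => ⟨fun V hV =>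
    (DistribSMul.toAddMonoidHom (Sec G V) (fres hV f)).comp (P.app V hV), by
      intro V W hV hW s
      change fres (hW.trans hV) f • P.app W _ _ = res G hW (fres hV f • P.app V _ _)
      rw [P.naturality V W hV hW, res_smul, fres_fres]⟩⟩

@[simp] theorem zero_app (hV : V ≤ U) (s : Sec F V) : (0 : AbHom F G U).app V hV s = 0 := rfl
@[simp] theorem add_app (P Q : AbHom F G U) (hV : V ≤ U) (s : Sec F V) :
    (P + Q).app V hV s = P.app V hV s + Q.app V hV s := rfl
@[simp] theorem neg_app (P : AbHom F G U) (hV : V ≤ U) (s : Sec F V) :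
    (-P).app V hV s = -P.app V hV s := rfl
@[simp] theorem smul_app (f : Fn X U) (P : AbHom F G U) (hV : V ≤ U) (s : Sec F V) :
    (f • P).app V hV s = fres hV f • P.app V hV s := rfl

instance : AddCommGroup (AbHom F G U) where
  add_assoc _ _ _ := ext' fun _ _ _ => add_assoc _ _ _
  zero_add _ := ext' fun _ _ _ => zero_add _
  add_zero _ := ext' fun _ _ _ => add_zero _
  add_comm _ _ := ext' fun _ _ _ => add_comm _ _
  neg_add_cancel _ := ext' fun _ _ _ => neg_add_cancel _
  nsmul := nsmulRec
  zsmul := zsmulRec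

@[simp] theorem sub_app (P Q : AbHom F G U) (hV : V ≤ U) (s : Sec F V) :
    (P - Q).app V hV s = P.app V hV s - Q.app V hV s := by
  rw [sub_eq_add_neg, sub_eq_add_neg]; rfl

instance : Module (Fn X U) (AbHom F G U) where
  one_smul _ := ext' fun _ _ _ => by simp
  mul_smul _ _ _ := ext' fun _ _ _ => by simp [mul_smul]
  smul_zero _ := ext' fun _ _ _ => by simp
  smul_add _ _ _ := ext' fun _ _ _ => by simp
  add_smul _ _ _ := ext' fun _ _ _ => by simp [add_smul]
  zero_smul _ := ext' fun _ _ _ => by simp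

/-- Restriction of a morphism `F|_U → G|_U` to `V ⊆ U`. -/
def restrict (h : V ≤ U) : AbHom F G U →+ AbHom F G V where
  toFun P := ⟨fun W hW => P.app W (hW.trans h), fun W W' hW hW' s =>
    P.naturality W W' (hW.trans h) hW' s⟩
  map_zero' := rfl
  map_add' _ _ := rfl

@[simp] theorem restrict_app (h : V ≤ U) (P : AbHom F G U) (hW : W ≤ V) (s : Sec F W) :
    (restrict h P).app W hW s = P.app W (hW.trans h) s := rfl

theorem restrict_smul (h : V ≤ U) (f : Fn X U) (P : AbHom F G U) :
    restrict h (f • P) = fres h f • restrict h P :=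
  ext' fun _ _ _ => by simp [fres_fres]

end AbHom

/-- The presheaf `U ↦ Hom_ℤ(F|_U, G|_U)`. -/
def abHomPresheaf (F G : OModule X) : (Opens X.carrier)ᵒᵖ ⥤ AddCommGrpCat.{u} where
  obj U := AddCommGrpCat.of (AbHom F G U.unop)
  map i := AddCommGrpCat.ofHom (AbHom.restrict i.unop.le)

instance (F G : OModule X) (U : (Opens X.carrier)ᵒᵖ) :
    Module ((ringSheaf X).obj.obj U) ((abHomPresheaf F G).obj U) :=
  inferInstanceAs (Module (Fn X U.unop) (AbHom F G U.unop))

theorem abHomPresheaf_isSheaf (F G : OModule X) :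
    Presheaf.IsSheaf (Opens.grothendieckTopology X.carrier) (abHomPresheaf F G) := by
  refine (TopCat.Presheaf.isSheaf_iff_isSheafUniqueGluing (abHomPresheaf F G)).mpr ?_
  intro ι U P hP
  change ∀ i, AbHom F G (U i) at P
  have hP' : ∀ i j, AbHom.restrict (inf_le_left : U i ⊓ U j ≤ U i) (P i) =
    AbHom.restrict (inf_le_right : U i ⊓ U j ≤ U j) (P j) := hP
  have hPapp : ∀ i j W (hi : W ≤ U i) (hj : W ≤ U j) (s : Sec F W),
      (P i).app W hi s = (P j).app W hj s := fun i j W hi hj s =>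
    congr(AbHom.app $(hP' i j) W (le_inf hi hj) s)
  have hcov : ∀ V, V ≤ iSup U → V ≤ ⨆ i, V ⊓ U i := fun V hV => by
    rw [← inf_iSup_eq]; exact le_inf le_rfl hV
  have key : ∀ V, V ≤ iSup U → ∀ s : Sec F V, ∃ t : Sec G V, ∀ i,
      res G (inf_le_left : V ⊓ U i ≤ V) t = (P i).app (V ⊓ U i) inf_le_right (res F inf_le_left s) := by
    intro V hV s
    refine sec_glue G (fun i => V ⊓ U i) (fun i => inf_le_left) (hcov V hV) _ ?_
    intro i j
    rw [← (P i).naturality, ← (P j).naturality, res_res, res_res]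
    exact hPapp _ _ _ _ _ _
  choose Q hQ using key
  have uniq : ∀ V (hV : V ≤ iSup U) (t t' : Sec G V),
      (∀ i, res G (inf_le_left : V ⊓ U i ≤ V) t = res G (inf_le_left : V ⊓ U i ≤ V) t') → t = t' :=
    fun V hV t t' h => sec_ext G (fun i => V ⊓ U i) (fun i => inf_le_left) (hcov V hV) h
  let q : AbHom F G (iSup U) :=
    { app := fun V hV => AddMonoidHom.mk' (Q V hV) (fun a b => uniq V hV _ _ fun i => by
        simp [hQ])
      naturality := by
        intro V W hV hW s
        refine uniq W (hW.trans hV) _ _ fun i => ?_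
        have h1 := (P i).naturality (V ⊓ U i) (W ⊓ U i) inf_le_right
          (inf_le_inf_right _ hW) (res F inf_le_left s)
        rw [← hQ V hV s i, res_res, res_res] at h1
        simp only [AddMonoidHom.mk'_apply, res_res]
        rw [hQ, res_res]
        exact h1 }
  refine ⟨q, fun i => AbHom.ext' fun V hV s => ?_, fun r hr => AbHom.ext' fun V hV s => ?_⟩
  · refine uniq V (hV.trans (le_iSup U i)) _ _ fun j => ?_
    refine (hQ V (hV.trans (le_iSup U i)) s j).trans ?_
    rw [← (P i).naturality V (V ⊓ U j) hV inf_le_left]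
    exact hPapp _ _ _ _ _ _
  · refine uniq V hV _ _ fun j => ?_
    refine Eq.trans ?_ (hQ V hV s j).symm
    rw [← r.naturality V (V ⊓ U j) hV inf_le_left]
    have : AbHom.restrict (le_iSup U j) r = P j := hr j
    rw [← this]
    rfl

/-- The `𝒪_X`-module `ℋom_ℤ(F, G)` of morphisms of sheaves of abelian groups. -/
def abHom (F G : OModule X) : OModule X where
  val := PresheafOfModules.ofPresheaf (abHomPresheaf F G)
    (fun _ _ i f P => AbHom.restrict_smul i.unop.le f P)
  isSheaf := abHomPresheaf_isSheaf F G

/-- The subsheaf of `𝒪_X`-modules of `M` cut out by a family of submodules that is stable under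
restriction and of local nature. -/
def subsheaf (M : OModule X) (N : M.val.Submodule)
    (hN : ∀ (ι : Type u) (U : ι → Opens X.carrier) (s : Sec M (iSup U)),
      (∀ i, res M (le_iSup U i) s ∈ N.obj (op (U i))) → s ∈ N.obj (op (iSup U))) : OModule X where
  val := N.toPresheafOfModules
  isSheaf := by
    refine (TopCat.Presheaf.isSheaf_iff_isSheafUniqueGluing
      (X := X.carrier) (C := AddCommGrpCat.{u}) N.toPresheafOfModules.presheaf).mpr ?_
    intro ι U s hs
    change ∀ i, N.obj (op (U i)) at s
    obtain ⟨t, ht⟩ := sec_glue M U (le_iSup U) le_rfl (fun i => (s i).1)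
      (fun i j => congr(Subtype.val $(hs i j)))
    refine ⟨⟨t, hN ι U t fun i => ?_⟩, fun i => Subtype.ext (ht i), fun r hr => Subtype.ext ?_⟩
    · rw [ht i]; exact (s i).2
    · exact sec_ext M U (le_iSup U) le_rfl fun i => (congr(Subtype.val $(hr i))).trans (ht i).symm

/-! ### `𝒪_X`-linear maps, first order `S`-differential operators, `S`-derivations -/

section conditions

variable {F G H : OModule X} {U V : Opens X.carrier}

/-- `P : F|_U → G|_U` is a morphism of `𝒪_U`-modules. -/
def IsOLinear (P : AbHom F G U) : Prop :=
  ∀ (V : Opens X.carrier) (hV : V ≤ U) (f : Fn X V) (s : Sec F V),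
    P.app V hV (f • s) = f • P.app V hV s

/-- The function `(π^♯ g)|_V` on `V ⊆ π⁻¹(W)`, for `g ∈ 𝒪_S(W)`. -/
def pull (π : X ⟶ S) {W : Opens S.carrier} (hV : V ≤ (Opens.map π.hom.base).obj W)
    (g : Fn S W) : Fn X V :=
  fres hV ((π.hom.c.app (op W)).hom g)

/-- `P : F|_U → G|_U` is `S`-linear. -/
def IsSLinear (π : X ⟶ S) (P : AbHom F G U) : Prop :=
  ∀ (W : Opens S.carrier) (V : Opens X.carrier) (hV : V ≤ U)
    (hW : V ≤ (Opens.map π.hom.base).obj W) (g : Fn S W) (s : Sec F V),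
    P.app V hV (pull π hW g • s) = pull π hW g • P.app V hV s

/-- The bracket `[P, f] : s ↦ P(f s) - f P(s)`, for `P : F|_U → G|_U` and `f ∈ 𝒪_X(U)`. -/
def bracket (P : AbHom F G U) (f : Fn X U) : AbHom F G U where
  app V hV := (P.app V hV).comp (DistribSMul.toAddMonoidHom (Sec F V) (fres hV f)) -
    (DistribSMul.toAddMonoidHom (Sec G V) (fres hV f)).comp (P.app V hV)
  naturality V W hV hW s := by
    change P.app W _ (fres (hW.trans hV) f • res F hW s) -
      fres (hW.trans hV) f • P.app W _ (res F hW s) =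
      res G hW (P.app V hV (fres hV f • s) - fres hV f • P.app V hV s)
    rw [map_sub, ← P.naturality V W hV hW, res_smul, res_smul, fres_fres, P.naturality V W hV hW]

@[simp] theorem bracket_app (P : AbHom F G U) (f : Fn X U) (hV : V ≤ U) (s : Sec F V) :
    (bracket P f).app V hV s = P.app V hV (fres hV f • s) - fres hV f • P.app V hV s := rfl

/-- `P : F|_U → G|_U` is a first order `S`-differential operator. -/
def IsDiffOp (π : X ⟶ S) (P : AbHom F G U) : Prop :=
  IsSLinear π P ∧ ∀ (V : Opens X.carrier) (hV : V ≤ U) (f : Fn X V),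
    IsOLinear (bracket (AbHom.restrict hV P) f)

/-- The structure sheaf `𝒪_X` as an `𝒪_X`-module. -/
abbrev unitO (X : RingedSpace.{u, u}) : OModule X := SheafOfModules.unit (ringSheaf X)

/-- A function, regarded as a section of the `𝒪_X`-module `𝒪_X`. -/
def toSec (f : Fn X U) : Sec (unitO X) U := f

/-- `δ : 𝒪_U → H|_U` is an `S`-derivation. -/
def IsDerivation (π : X ⟶ S) (δ : AbHom (unitO X) H U) : Prop :=
  IsSLinear π δ ∧ ∀ (V : Opens X.carrier) (hV : V ≤ U) (a b : Fn X V),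
    δ.app V hV (toSec (a * b)) = a • δ.app V hV (toSec b) + b • δ.app V hV (toSec a)

/-! The three conditions are stable under sums, multiples and restriction, and are local. -/

theorem fres_pull (π : X ⟶ S) {V' : Opens X.carrier} {W : Opens S.carrier}
    (hV : V ≤ (Opens.map π.hom.base).obj W) (h : V' ≤ V) (g : Fn S W) :
    fres h (pull π hV g) = pull π (h.trans hV) g :=
  fres_fres _ _ _

theorem bracket_restrict (P : AbHom F G U) (h : V ≤ U) (f : Fn X U) :
    bracket (AbHom.restrict h P) (fres h f) = AbHom.restrict h (bracket P f) :=
  AbHom.ext' fun _ _ _ => by simp [fres_fres]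

theorem bracket_add (P Q : AbHom F G U) (f : Fn X U) :
    bracket (P + Q) f = bracket P f + bracket Q f :=
  AbHom.ext' fun _ _ _ => by simp; abel

theorem bracket_smul (a : Fn X U) (P : AbHom F G U) (f : Fn X U) :
    bracket (a • P) f = a • bracket P f :=
  AbHom.ext' fun _ hV _ => by simp [smul_sub, smul_comm (fres hV f)]

theorem bracket_restrict_smul (h : V ≤ U) (a : Fn X U) (P : AbHom F G U) (f : Fn X V) :
    bracket (AbHom.restrict h (a • P)) f = fres h a • bracket (AbHom.restrict h P) f := by
  rw [AbHom.restrict_smul, bracket_smul]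

theorem bracket_fn_add (P : AbHom F G U) (f g : Fn X U) :
    bracket P (f + g) = bracket P f + bracket P g :=
  AbHom.ext' fun _ _ _ => by simp [add_smul]; abel

theorem IsOLinear.zero : IsOLinear (0 : AbHom F G U) := fun _ _ _ _ => by simp

theorem IsOLinear.add {P Q : AbHom F G U} (hP : IsOLinear P) (hQ : IsOLinear Q) :
    IsOLinear (P + Q) := fun V hV f s => by
  simp [hP V hV f s, hQ V hV f s]

theorem IsOLinear.smul {P : AbHom F G U} (hP : IsOLinear P) (a : Fn X U) :
    IsOLinear (a • P) := fun V hV f s => by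
  simp [hP V hV f s, smul_comm (fres hV a)]

theorem IsOLinear.restrict {P : AbHom F G U} (hP : IsOLinear P) (h : V ≤ U) :
    IsOLinear (AbHom.restrict h P) := fun W hW f s => hP W (hW.trans h) f s

theorem inf_cover {ι : Type u} (U : ι → Opens X.carrier) (hV : V ≤ iSup U) :
    V ≤ ⨆ i, V ⊓ U i := by
  rw [← inf_iSup_eq]; exact le_inf le_rfl hV

theorem IsOLinear.of_local {ι : Type u} {U : ι → Opens X.carrier} {P : AbHom F G (iSup U)}
    (hP : ∀ i, IsOLinear (AbHom.restrict (le_iSup U i) P)) : IsOLinear P := fun V hV f s => by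
  refine sec_ext G _ (fun i => (inf_le_left : V ⊓ U i ≤ V)) (inf_cover U hV) fun i => ?_
  rw [← P.naturality, res_smul, res_smul, ← P.naturality]
  exact hP i (V ⊓ U i) inf_le_right _ _

theorem IsSLinear.zero {π : X ⟶ S} : IsSLinear π (0 : AbHom F G U) := fun _ _ _ _ _ _ => by simp

theorem IsSLinear.add {π : X ⟶ S} {P Q : AbHom F G U} (hP : IsSLinear π P) (hQ : IsSLinear π Q) :
    IsSLinear π (P + Q) := fun W V hV hW f s => by
  simp [hP W V hV hW f s, hQ W V hV hW f s]

theorem IsSLinear.smul {π : X ⟶ S} {P : AbHom F G U} (hP : IsSLinear π P) (a : Fn X U) :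
    IsSLinear π (a • P) := fun W V hV hW f s => by
  simp [hP W V hV hW f s, smul_comm (fres hV a)]

theorem IsSLinear.restrict {π : X ⟶ S} {P : AbHom F G U} (hP : IsSLinear π P) (h : V ≤ U) :
    IsSLinear π (AbHom.restrict h P) := fun W V hV hW f s => hP W V (hV.trans h) hW f s

theorem IsSLinear.of_local {π : X ⟶ S} {ι : Type u} {U : ι → Opens X.carrier}
    {P : AbHom F G (iSup U)} (hP : ∀ i, IsSLinear π (AbHom.restrict (le_iSup U i) P)) :
    IsSLinear π P := fun W V hV hW f s => by
  refine sec_ext G _ (fun i => (inf_le_left : V ⊓ U i ≤ V)) (inf_cover U hV) fun i => ?_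
  rw [← P.naturality, res_smul, res_smul, ← P.naturality, fres_pull]
  exact hP i W (V ⊓ U i) inf_le_right _ _ _

theorem IsOLinear.isSLinear {P : AbHom F G U} (hP : IsOLinear P) (π : X ⟶ S) : IsSLinear π P :=
  fun _ V hV _ _ s => hP V hV _ s

theorem IsOLinear.bracket_eq_zero {P : AbHom F G U} (hP : IsOLinear P) (f : Fn X U) :
    bracket P f = 0 :=
  AbHom.ext' fun V hV s => by simp [hP V hV]

theorem IsOLinear.isDiffOp {P : AbHom F G U} (hP : IsOLinear P) (π : X ⟶ S) : IsDiffOp π P :=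
  ⟨hP.isSLinear π, fun V hV f => by
    rw [(hP.restrict hV).bracket_eq_zero f]; exact IsOLinear.zero⟩

theorem IsDiffOp.add {π : X ⟶ S} {P Q : AbHom F G U} (hP : IsDiffOp π P) (hQ : IsDiffOp π Q) :
    IsDiffOp π (P + Q) :=
  ⟨hP.1.add hQ.1, fun V hV f => by
    rw [map_add, bracket_add]; exact (hP.2 V hV f).add (hQ.2 V hV f)⟩

theorem IsDiffOp.smul {π : X ⟶ S} {P : AbHom F G U} (hP : IsDiffOp π P) (a : Fn X U) :
    IsDiffOp π (a • P) :=
  ⟨hP.1.smul a, fun V hV f => by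
    rw [bracket_restrict_smul]; exact (hP.2 V hV f).smul _⟩

theorem IsDiffOp.restrict {π : X ⟶ S} {P : AbHom F G U} (hP : IsDiffOp π P) (h : V ≤ U) :
    IsDiffOp π (AbHom.restrict h P) :=
  ⟨hP.1.restrict h, fun W hW f => hP.2 W (hW.trans h) f⟩

theorem IsDiffOp.of_local {π : X ⟶ S} {ι : Type u} {U : ι → Opens X.carrier}
    {P : AbHom F G (iSup U)} (h : ∀ i, IsDiffOp π (AbHom.restrict (le_iSup U i) P)) :
    IsDiffOp π P :=
  ⟨IsSLinear.of_local fun i => (h i).1, fun V hV f W hW a s => by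
    refine sec_ext G _ (fun i => (inf_le_left : W ⊓ U i ≤ W)) (inf_cover U (hW.trans hV))
      fun i => ?_
    rw [← (bracket _ _).naturality, res_smul, res_smul, ← (bracket _ _).naturality]
    have h1 := (h i).2 (W ⊓ U i) inf_le_right (fres (inf_le_left.trans hW) f) (W ⊓ U i) le_rfl
      (fres inf_le_left a) (res F inf_le_left s)
    simp only [bracket_app, fres_fres] at h1 ⊢
    exact h1⟩

theorem IsDerivation.zero {π : X ⟶ S} : IsDerivation π (0 : AbHom (unitO X) H U) :=
  ⟨IsSLinear.zero, fun V hV a b => by simp⟩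

theorem IsDerivation.add {π : X ⟶ S} {P Q : AbHom (unitO X) H U} (hP : IsDerivation π P)
    (hQ : IsDerivation π Q) : IsDerivation π (P + Q) :=
  ⟨hP.1.add hQ.1, fun V hV a b => by
    rw [AbHom.add_app, AbHom.add_app, AbHom.add_app, hP.2, hQ.2, smul_add, smul_add]
    abel⟩

theorem IsDerivation.smul {π : X ⟶ S} {P : AbHom (unitO X) H U} (hP : IsDerivation π P)
    (c : Fn X U) : IsDerivation π (c • P) :=
  ⟨hP.1.smul c, fun V hV a b => by
    rw [AbHom.smul_app, AbHom.smul_app, AbHom.smul_app, hP.2, smul_add, smul_comm a, smul_comm b]⟩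

theorem IsDerivation.restrict {π : X ⟶ S} {P : AbHom (unitO X) H U} (hP : IsDerivation π P)
    (h : V ≤ U) : IsDerivation π (AbHom.restrict h P) :=
  ⟨hP.1.restrict h, fun W hW a b => hP.2 W (hW.trans h) a b⟩

theorem res_toSec (h : V ≤ U) (f : Fn X U) : res (unitO X) h (toSec f) = toSec (fres h f) := rfl

theorem IsDerivation.of_local {π : X ⟶ S} {ι : Type u} {U : ι → Opens X.carrier}
    {δ : AbHom (unitO X) H (iSup U)}
    (h : ∀ i, IsDerivation π (AbHom.restrict (le_iSup U i) δ)) : IsDerivation π δ :=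
  ⟨IsSLinear.of_local fun i => (h i).1, fun V hV a b => by
    refine sec_ext H _ (fun i => (inf_le_left : V ⊓ U i ≤ V)) (inf_cover U hV) fun i => ?_
    have h1 := (h i).2 (V ⊓ U i) inf_le_right (fres inf_le_left a) (fres inf_le_left b)
    rw [map_add, res_smul, res_smul, ← δ.naturality, ← δ.naturality, ← δ.naturality, res_toSec,
      res_toSec, res_toSec, map_mul]
    exact h1⟩

end conditions

section sheaves

variable (π : X ⟶ S) (F G H : OModule X)

/-- The submodules of `𝒪_X`-linear maps. -/
def homSub : (abHom F G).val.Submodule where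
  obj U :=
    { carrier := {P : AbHom F G U.unop | IsOLinear P}
      zero_mem' := IsOLinear.zero
      add_mem' := fun hP hQ => hP.add hQ
      smul_mem' := fun a _ hP => IsOLinear.smul hP a }
  map i _ hP := IsOLinear.restrict hP i.unop.le

/-- The submodules of first order `S`-differential operators. -/
def diffSub : (abHom F G).val.Submodule where
  obj U :=
    { carrier := {P : AbHom F G U.unop | IsDiffOp π P}
      zero_mem' := IsOLinear.zero.isDiffOp π
      add_mem' := fun hP hQ => hP.add hQ
      smul_mem' := fun a _ hP => IsDiffOp.smul hP a }
  map i _ hP := IsDiffOp.restrict hP i.unop.le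

/-- The submodules of `S`-derivations. -/
def derSub : (abHom (unitO X) H).val.Submodule where
  obj U :=
    { carrier := {δ : AbHom (unitO X) H U.unop | IsDerivation π δ}
      zero_mem' := IsDerivation.zero
      add_mem' := fun hP hQ => hP.add hQ
      smul_mem' := fun a _ hP => IsDerivation.smul hP a }
  map i _ hP := IsDerivation.restrict hP i.unop.le

/-- The `𝒪_X`-module `ℋom_{𝒪_X}(F, G)`. -/
def homO : OModule X := subsheaf (abHom F G) (homSub F G) fun _ _ _ h => IsOLinear.of_local h

/-- The `𝒪_X`-module `𝒟iff¹_S(F, G)`. -/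
def diffO : OModule X := subsheaf (abHom F G) (diffSub π F G) fun _ _ _ h => IsDiffOp.of_local h

/-- The `𝒪_X`-module `𝒟er_S(𝒪_X, H)`. -/
def derO : OModule X :=
  subsheaf (abHom (unitO X) H) (derSub π H) fun _ _ _ h => IsDerivation.of_local h

/-- The inclusion `ι : ℋom_{𝒪_X}(F, G) ⟶ 𝒟iff¹_S(F, G)`. -/
def incl : homO F G ⟶ diffO π F G :=
  ⟨PresheafOfModules.Submodule.homOfLE fun _ _ hP => IsOLinear.isDiffOp hP π⟩

variable {F G} in
/-- The symbol of a first order `S`-differential operator `P : F|_U → G|_U`: the morphism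
`θ : 𝒪_U → ℋom_{𝒪_X}(F, G)|_U` with `θ_V(f) = [P|_V, f]`. -/
def symbolHom {U : Opens X.carrier} (P : AbHom F G U) (hP : IsDiffOp π P) :
    AbHom (unitO X) (homO F G) U where
  app V hV := AddMonoidHom.mk' (fun f : Fn X V => ⟨bracket (AbHom.restrict hV P) f, hP.2 V hV f⟩)
    fun f g => Subtype.ext (bracket_fn_add _ f g)
  naturality _ _ hV hW f := Subtype.ext (bracket_restrict (AbHom.restrict hV P) hW f)

variable {F G} in
theorem symbolHom_isDerivation {U : Opens X.carrier} (P : AbHom F G U) (hP : IsDiffOp π P) :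
    IsDerivation π (symbolHom π P hP) := by
  constructor
  · intro W V hV hW g (f : Fn X V)
    refine Subtype.ext (AbHom.ext' fun V' hV' s => ?_)
    change P.app V' _ (fres hV' (pull π hW g * f) • s) -
        fres hV' (pull π hW g * f) • P.app V' _ s =
      fres hV' (pull π hW g) • (P.app V' _ (fres hV' f • s) -
        fres hV' f • P.app V' _ s)
    rw [map_mul, mul_smul, mul_smul, smul_sub, fres_pull, hP.1]
  · intro V hV a b
    refine Subtype.ext (AbHom.ext' fun V' hV' s => ?_)
    change P.app V' _ (fres hV' (a * b) • s) - fres hV' (a * b) • P.app V' _ s =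
      fres hV' a • (P.app V' _ (fres hV' b • s) - fres hV' b • P.app V' _ s) +
      fres hV' b • (P.app V' _ (fres hV' a • s) - fres hV' a • P.app V' _ s)
    have h := hP.2 V hV a V' hV' (fres hV' b) s
    simp only [bracket_app, AbHom.restrict_app] at h
    rw [map_mul, mul_smul, mul_smul, ← h, smul_sub]
    abel

/-- The symbol morphism `σ₁ : 𝒟iff¹_S(F, G) ⟶ 𝒟er_S(𝒪_X, ℋom_{𝒪_X}(F, G))`. -/
def symbol : diffO π F G ⟶ derO π (homO F G) where
  val := PresheafOfModules.homMk
    { app U := AddCommGrpCat.ofHom (AddMonoidHom.mk'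
        (fun P : (diffSub π F G).obj U =>
          (⟨symbolHom π P.1 P.2, symbolHom_isDerivation π P.1 P.2⟩ : (derSub π (homO F G)).obj U))
        (fun P Q => Subtype.ext (AbHom.ext' fun _ hV f => Subtype.ext
          (bracket_add (AbHom.restrict hV P.1) (AbHom.restrict hV Q.1) f))))
      naturality _ _ _ := rfl }
    (fun _ a P => Subtype.ext (AbHom.ext' fun _ hV f => Subtype.ext
      (bracket_restrict_smul hV a P.1 f)))

/-- The sequence `ℋom_{𝒪_X}(F, G) ⟶ 𝒟iff¹_S(F, G) ⟶ 𝒟er_S(𝒪_X, ℋom_{𝒪_X}(F, G))` of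
`𝒪_X`-modules. -/
def symbolSequence : ShortComplex (OModule X) where
  f := incl π F G
  g := symbol π F G
  zero := by
    ext U P
    exact Subtype.ext (AbHom.ext' fun _ hV f => Subtype.ext
      (IsOLinear.bracket_eq_zero (IsOLinear.restrict P.2 hV) f))

end sheaves

/-- `F` is a locally free `𝒪_X`-module of rank `r`: every point has an open neighbourhood `U`
with a frame `e₁, …, e_r ∈ F(U)`, i.e. `(c₁, …, c_r) ↦ ∑ cᵢ eᵢ` is an isomorphism
`𝒪_U^r ≅ F|_U`. -/
def IsLocallyFreeOfRank (F : OModule X) (r : ℕ) : Prop :=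
  ∀ x : X.carrier, ∃ U : Opens X.carrier, x ∈ U ∧ ∃ e : Fin r → Sec F U,
    ∀ (V : Opens X.carrier) (hV : V ≤ U),
      Function.Bijective fun c : Fin r → Fn X V => ∑ i, c i • res F hV (e i)

/-! ### Complex manifolds as ringed spaces -/

section manifolds

variable {E B : Type*} [NormedAddCommGroup E] [NormedSpace ℂ E] [NormedAddCommGroup B]
  [NormedSpace ℂ B] {M : Type} [TopologicalSpace M] [ChartedSpace E M]
  {N : Type} [TopologicalSpace N] [ChartedSpace B N]

/-- A complex manifold `M` as a ringed space: its structure sheaf is the sheaf of holomorphic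
functions, i.e. of the complex-valued functions that are smooth over `ℂ`. -/
def holSpace (E : Type*) [NormedAddCommGroup E] [NormedSpace ℂ E]
    (M : Type) [TopologicalSpace M] [ChartedSpace E M] : RingedSpace.{0, 0} :=
  (ChartedSpace.locallyRingedSpace 𝓘(ℂ, E) M).toSheafedSpace

/-- The morphism of ringed spaces of a holomorphic map `f`, with `f^♯ g = g ∘ f`. -/
def holMap (f : M → N) (hf : ContMDiff 𝓘(ℂ, E) 𝓘(ℂ, B) ∞ f) : holSpace E M ⟶ holSpace B N :=
  LocallyRingedSpace.forgetToSheafedSpace.map (ChartedSpace.locallyRingedSpaceMap f hf)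

end manifolds

end

end RelDiff

namespace RelDiff

noncomputable section

variable {X S : RingedSpace.{u, u}}

/-! The bracket `[P, f]` measures the failure of `P` to commute with multiplication by `f`. The
symbol of `P` therefore vanishes exactly when `P` is `𝒪`-linear, and `ι` is a kernel of `σ₁`
(`inclIsKernel`). This settles exactness on the left and in the middle.

Surjectivity is local and rests on frames of `F`. Given a frame `eᵢ` and a derivation `δ` with
values in `ℋom(F, G)`, put `P(∑ cᵢ eᵢ) = ∑ δ(cᵢ)(eᵢ)`. The Leibniz rule gives `P(f s) = f P(s) +
δ(f)(s)` (`IsFrame.operator_app_smul`), that is, `[P, f] = δ(f)`. So `P` is a first order operator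
with symbol `δ`, and its `S`-linearity comes from that of `δ`. The lift depends on the frame, so it
is only local, which is enough for an epimorphism of sheaves. -/

theorem isOLinear_of_bracket_eq_zero {F G : OModule X} {U : Opens X.carrier} {P : AbHom F G U}
    (h : ∀ (V : Opens X.carrier) (hV : V ≤ U) (f : Fn X V),
      bracket (AbHom.restrict hV P) f = 0) : IsOLinear P := fun V hV f s => by
  -- Evaluating over `V` itself makes the restriction of `f` trivial.
  have h1 := congr(AbHom.app $(h V hV f) V le_rfl s)
  rw [bracket_app, fres_self, AbHom.zero_app, sub_eq_zero] at h1
  exact h1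

/-! ### The kernel of the symbol -/

section kernel

variable (π : X ⟶ S) (F G : OModule X)

variable {F G} in
/-- A morphism into `𝒟iff¹_S(F, G)` that is killed by the symbol takes values in
`ℋom_{𝒪_X}(F, G)`. -/
def liftIncl {A : OModule X} (k : A ⟶ diffO π F G) (hk : k ≫ symbol π F G = 0) :
    A ⟶ homO F G where
  val := PresheafOfModules.homMk
    { app U := AddCommGrpCat.ofHom (AddMonoidHom.mk'
        (fun a : A.val.obj U =>
          (⟨((k.val.app U).hom a : (diffSub π F G).obj U).1,
            isOLinear_of_bracket_eq_zero fun V hV f => by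
              -- `hk` at the section `a` says that the symbol of `k(a)` is zero; evaluated at `f`
              -- over `V`, this is the vanishing of one bracket.
              have h1 := congr(((SheafOfModules.Hom.val $hk).app U).hom a)
              have h2 : symbolHom π ((k.val.app U).hom a : (diffSub π F G).obj U).1
                  ((k.val.app U).hom a : (diffSub π F G).obj U).2 = 0 := congr(Subtype.val $h1)
              exact congr(Subtype.val (AbHom.app $h2 V hV (toSec f)))⟩ :
            (homSub F G).obj U))
        (fun a b => Subtype.ext congr(Subtype.val $(map_add (k.val.app U).hom a b))))
      naturality U V i := by
        ext a
        exact Subtype.ext congr(Subtype.val $(PresheafOfModules.naturality_apply k.val i a)) }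
    (fun U c a => Subtype.ext congr(Subtype.val $(map_smul (k.val.app U).hom c a)))

/-- `ι` is a kernel of the symbol morphism. -/
def inclIsKernel : Limits.IsLimit
    (Limits.KernelFork.ofι (incl π F G) (symbolSequence π F G).zero) :=
  Limits.KernelFork.IsLimit.ofι _ _ (fun k hk => liftIncl π k hk)
    -- The lift and `ι` both leave the underlying operator unchanged, so the factorization is
    -- definitional; for the same reason it is unique.
    (fun _ _ => rfl)
    (fun k hk m hm => by
      ext U a
      exact Subtype.ext congr(Subtype.val (((SheafOfModules.Hom.val $hm).app U).hom a)))

end kernel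

/-! ### Lifting a derivation over a frame -/

section frames

variable {F G : OModule X} {U V W : Opens X.carrier} {r : ℕ}

/-- `e₁, …, e_r` is a frame of `F` over `U`. -/
def IsFrame (e : Fin r → Sec F U) : Prop :=
  ∀ (V : Opens X.carrier) (hV : V ≤ U),
    Function.Bijective fun c : Fin r → Fn X V => ∑ i, c i • res F hV (e i)

theorem IsFrame.restrict {e : Fin r → Sec F U} (he : IsFrame e) (h : V ≤ U) :
    IsFrame fun i => res F h (e i) := fun W hW => by
  simpa only [res_res] using he W (hW.trans h)

/-- The coordinates of a section with respect to a frame. -/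
def IsFrame.coord {e : Fin r → Sec F U} (he : IsFrame e) (hV : V ≤ U) :
    Sec F V ≃ₗ[Fn X V] (Fin r → Fn X V) :=
  (LinearEquiv.ofBijective
    (Fintype.linearCombination (Fn X V) fun i => res F hV (e i)) (he V hV)).symm

theorem IsFrame.sum_coord {e : Fin r → Sec F U} (he : IsFrame e) (hV : V ≤ U) (s : Sec F V) :
    ∑ i, he.coord hV s i • res F hV (e i) = s :=
  (he.coord hV).symm_apply_apply s

/-- Both families expand the same section in the restricted frame, and such an expansion is unique.
This makes the operator built from coordinates compatible with restriction. -/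
theorem IsFrame.coord_res {e : Fin r → Sec F U} (he : IsFrame e) (hV : V ≤ U) (hW : W ≤ V)
    (s : Sec F V) (i : Fin r) :
    he.coord (hW.trans hV) (res F hW s) i = fres hW (he.coord hV s i) := by
  refine congr_fun ((he W (hW.trans hV)).1 (a₂ := fun i => fres hW (he.coord hV s i)) ?_) i
  refine (he.sum_coord _ _).trans ?_
  conv_lhs => rw [← he.sum_coord hV s]
  simp only [map_sum, res_smul, res_res]

/-- The morphism of sheaves of abelian groups underlying a section of `ℋom_{𝒪_X}(F, G)`. -/
def homToAbHom (F G : OModule X) (U : Opens X.carrier) :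
    Sec (homO F G) U →ₗ[Fn X U] AbHom F G U :=
  ((homSub F G).obj (op U)).subtype

theorem homToAbHom_isOLinear (φ : Sec (homO F G) U) : IsOLinear (homToAbHom F G U φ) := φ.2

theorem homToAbHom_res (h : V ≤ U) (φ : Sec (homO F G) U) :
    homToAbHom F G V (res (homO F G) h φ) = AbHom.restrict h (homToAbHom F G U φ) := rfl

/-- The operator `∑ cᵢ eᵢ ↦ ∑ δ(cᵢ)(eᵢ)` associated with a frame `e₁, …, e_r` and a morphism
`δ : 𝒪_U → ℋom_{𝒪_X}(F, G)|_U`. -/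
def IsFrame.operator {e : Fin r → Sec F U} (he : IsFrame e)
    (δ : AbHom (unitO X) (homO F G) U) : AbHom F G U where
  app V hV := AddMonoidHom.mk'
    (fun s => ∑ i, (homToAbHom F G V (δ.app V hV (toSec (he.coord hV s i)))).app V le_rfl
      (res F hV (e i)))
    (fun s t => by
      rw [← Finset.sum_add_distrib]
      refine Finset.sum_congr rfl fun i _ => ?_
      -- Additivity of the coordinates lives in functions and that of `δ` in sections of `𝒪_X`; the
      -- two agree only up to unfolding `toSec`.
      have h : δ.app V hV (toSec (he.coord hV (s + t) i)) =
          δ.app V hV (toSec (he.coord hV s i)) + δ.app V hV (toSec (he.coord hV t i)) := by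
        rw [map_add]
        exact map_add (δ.app V hV) _ _
      rw [h, map_add, AbHom.add_app])
  naturality V W hV hW s := by
    simp only [AddMonoidHom.mk'_apply, map_sum]
    refine Finset.sum_congr rfl fun i _ => ?_
    rw [he.coord_res hV hW, ← res_toSec, δ.naturality V W hV hW, homToAbHom_res,
      AbHom.restrict_app, ← res_res F hV hW]
    exact (homToAbHom F G V _).naturality V W le_rfl hW _

theorem IsFrame.operator_app {e : Fin r → Sec F U} (he : IsFrame e)
    (δ : AbHom (unitO X) (homO F G) U) (hV : V ≤ U) (s : Sec F V) :
    (he.operator δ).app V hV s =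
      ∑ i, (homToAbHom F G V (δ.app V hV (toSec (he.coord hV s i)))).app V le_rfl
        (res F hV (e i)) := rfl

/-- Coordinates are `𝒪`-linear, and `δ` treats functions pulled back from `S` as constants. -/
theorem IsFrame.operator_isSLinear {π : X ⟶ S} {e : Fin r → Sec F U} (he : IsFrame e)
    {δ : AbHom (unitO X) (homO F G) U} (hδ : IsDerivation π δ) :
    IsSLinear π (he.operator δ) := fun W V hV hW g s => by
  rw [operator_app, operator_app, Finset.smul_sum]
  refine Finset.sum_congr rfl fun i _ => ?_
  have h : δ.app V hV (toSec (he.coord hV (pull π hW g • s) i)) =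
      pull π hW g • δ.app V hV (toSec (he.coord hV s i)) := by
    rw [map_smul]
    exact hδ.1 W V hV hW g _
  rw [h, map_smul, AbHom.smul_app, fres_self]

/-- With `cᵢ` the coordinates of `s`, those of `f s` are `f cᵢ`, and `δ(f cᵢ) = f δ(cᵢ) + cᵢ δ(f)`.
The second terms sum to `δ(f)(∑ cᵢ eᵢ)` because `δ(f)` is `𝒪`-linear. -/
theorem IsFrame.operator_app_smul {π : X ⟶ S} {e : Fin r → Sec F U} (he : IsFrame e)
    {δ : AbHom (unitO X) (homO F G) U} (hδ : IsDerivation π δ) (hV : V ≤ U) (f : Fn X V)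
    (s : Sec F V) :
    (he.operator δ).app V hV (f • s) = f • (he.operator δ).app V hV s +
      (homToAbHom F G V (δ.app V hV (toSec f))).app V le_rfl s := by
  -- Every `s` is expanded in the frame, the sum is pulled out of `δ(f)` only, and the last rewrite
  -- restores `s` inside the operator.
  conv_rhs => rw [← he.sum_coord hV s, map_sum ((homToAbHom F G V _).app V le_rfl),
    he.sum_coord hV s]
  rw [operator_app, operator_app, Finset.smul_sum, ← Finset.sum_add_distrib]
  refine Finset.sum_congr rfl fun i _ => ?_
  have h : δ.app V hV (toSec (he.coord hV (f • s) i)) =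
      f • δ.app V hV (toSec (he.coord hV s i)) + he.coord hV s i • δ.app V hV (toSec f) := by
    rw [map_smul]
    exact hδ.2 V hV f _
  rw [h, map_add, map_smul, map_smul, AbHom.add_app, AbHom.smul_app, AbHom.smul_app, fres_self,
    fres_self, homToAbHom_isOLinear]

/-- Over `W ⊆ V` the Leibniz rule leaves `δ(f|_W)`, which is `δ(f)|_W` by naturality of `δ`. -/
theorem IsFrame.bracket_operator {π : X ⟶ S} {e : Fin r → Sec F U} (he : IsFrame e)
    {δ : AbHom (unitO X) (homO F G) U} (hδ : IsDerivation π δ) (hV : V ≤ U) (f : Fn X V) :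
    bracket (AbHom.restrict hV (he.operator δ)) f = homToAbHom F G V (δ.app V hV (toSec f)) :=
  AbHom.ext' fun W hW s => by
    rw [bracket_app, AbHom.restrict_app, AbHom.restrict_app, he.operator_app_smul hδ,
      add_sub_cancel_left, ← res_toSec, δ.naturality V W hV hW, homToAbHom_res, AbHom.restrict_app]

theorem IsFrame.operator_isDiffOp {π : X ⟶ S} {e : Fin r → Sec F U} (he : IsFrame e)
    {δ : AbHom (unitO X) (homO F G) U} (hδ : IsDerivation π δ) : IsDiffOp π (he.operator δ) :=
  ⟨he.operator_isSLinear hδ, fun V hV f => by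
    rw [he.bracket_operator hδ hV f]; exact homToAbHom_isOLinear _⟩

theorem IsFrame.symbolHom_operator {π : X ⟶ S} {e : Fin r → Sec F U} (he : IsFrame e)
    {δ : AbHom (unitO X) (homO F G) U} (hδ : IsDerivation π δ) :
    symbolHom π (he.operator δ) (he.operator_isDiffOp hδ) = δ :=
  AbHom.ext' fun _ hV f => Subtype.ext (he.bracket_operator hδ hV f)

end frames

/-! ### Local surjectivity and short exactness -/

section exactness

variable (π : X ⟶ S) {F : OModule X} (G : OModule X) {r : ℕ}

theorem symbol_isLocallySurjective (hF : IsLocallyFreeOfRank F r) :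
    PresheafOfModules.IsLocallySurjective (Opens.grothendieckTopology X.carrier)
      (symbol π F G).val where
  imageSieve_mem {U} δ := by
    intro x hx
    obtain ⟨V, hxV, e, he : IsFrame e⟩ := hF x
    have hδ : IsDerivation π (AbHom.restrict (inf_le_left : U ⊓ V ≤ U) δ.1) :=
      IsDerivation.restrict δ.2 _
    have he' := he.restrict (inf_le_right : U ⊓ V ≤ V)
    -- The derivation lives on `U` and the frame on `V`, so the preimage is built on `U ⊓ V`.
    exact ⟨U ⊓ V, homOfLE inf_le_left,
      ⟨(⟨he'.operator _, he'.operator_isDiffOp hδ⟩ : (diffSub π F G).obj (op (U ⊓ V))),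
        Subtype.ext (he'.symbolHom_operator hδ)⟩, hx, hxV⟩

theorem symbolSequence_shortExact (hF : IsLocallyFreeOfRank F r) :
    (symbolSequence π F G).ShortExact := by
  -- Being a kernel encodes both exactness in the middle and injectivity of `ι`.
  obtain ⟨hexact, hmono⟩ :=
    (symbolSequence π F G).exact_and_mono_f_iff_f_is_kernel.2 ⟨inclIsKernel π F G⟩
  have hsurj : Sheaf.IsLocallySurjective ((SheafOfModules.toSheaf _).map (symbol π F G)) :=
    symbol_isLocallySurjective π G hF
  have : Epi ((SheafOfModules.toSheaf _).map (symbol π F G)) :=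
    (Sheaf.isLocallySurjective_iff_epi' _ _).1 hsurj
  -- Local surjectivity gives an epimorphism of abelian sheaves, and the forgetful functor from
  -- `𝒪_X`-modules reflects epimorphisms.
  have hepi : Epi (symbol π F G) := (SheafOfModules.toSheaf _).epi_of_epi_map this
  exact { exact := hexact, mono_f := hmono, epi_g := hepi }

end exactness

end

end RelDiff

theorem proposition4
    {E B : Type*} [NormedAddCommGroup E] [NormedSpace ℂ E] [FiniteDimensional ℂ E]
    [NormedAddCommGroup B] [NormedSpace ℂ B] [FiniteDimensional ℂ B]
    {X S : Type} [TopologicalSpace X] [ChartedSpace E X] [IsManifold 𝓘(ℂ, E) ∞ X]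
    [TopologicalSpace S] [ChartedSpace B S] [IsManifold 𝓘(ℂ, B) ∞ S]
    (π : X → S) (hπ : ContMDiff 𝓘(ℂ, E) 𝓘(ℂ, B) ∞ π)
    (hsub : ∀ x : X, Function.Surjective (mfderiv 𝓘(ℂ, E) 𝓘(ℂ, B) π x))
    (hproper : IsProperMap π)
    (hconn : ∀ t : S, IsPreconnected (π ⁻¹' {t}))
    (F G : RelDiff.OModule (RelDiff.holSpace E X)) (r p : ℕ)
    (hF : RelDiff.IsLocallyFreeOfRank F r) (hG : RelDiff.IsLocallyFreeOfRank G p) :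
    (RelDiff.symbolSequence (RelDiff.holMap π hπ) F G).ShortExact ∧
      PresheafOfModules.IsLocallySurjective (Opens.grothendieckTopology (TopCat.of X))
        (RelDiff.symbol (RelDiff.holMap π hπ) F G).val := by
  -- The argument is valid for any morphism of ringed spaces; here it is applied to the sheaves of
  -- holomorphic functions.
  exact ⟨RelDiff.symbolSequence_shortExact _ G hF, RelDiff.symbol_isLocallySurjective _ G hF⟩
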